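/- For $0<\alpha<1$ and $\beta\in\mathbb{C}$ let $E_{\alpha,\beta}(z)=\sum_{k=0}^{\infty}\frac{z^k}{\Gamma(\alpha k+\beta)}$, $z\in\mathbb{C}$, be the Mittag-Leffler function (with $1/\Gamma=0$ at the poles of $\Gamma$), and let $E_\alpha=E_{\alpha,1}$. Let $0<\alpha<1$, let $\lambda\in\mathbb{C}\setminus\{0\}$ with $\frac{\alpha\pi}{2}<|\arg(\lambda)|\le\pi$, where $\arg(\lambda)\in(-\pi,\pi]$, and let $l\in\mathbb{N}=\{0,1,2,\dots\}$. Then there exist positive constants $M_l(\alpha,\lambda)$, $\hat M_l(\alpha,\lambda)$ and a positive real number $t_0$ such that the following statements hold: (i) $\left|\frac{d^l}{d\lambda^l}E_\alpha(\lambda t^\alpha)\right|\le\frac{M_l(\alpha,\lambda)}{t^\alpha}$ for every $t>t_0$; (ii) $\left|\frac{d^l}{d\lambda^l}E_{\alpha,\alpha}(\lambda t^\alpha)\right|\le\frac{\hat M_l(\alpha,\lambda)}{t^{2\alpha}}$ for every $t>t_0$. Here $\frac{d^l}{d\lambda^l}$ is the $l$-th complex derivative with respect to $\lambda$, for fixed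 $t$. -/

import Mathlib

/-- The two-parameter Mittag-Leffler function
`E_{α,β}(z) = ∑_{k ≥ 0} z ^ k / Γ(α k + β)`, for a real order `α > 0` (for which the series
converges for every complex `z`) and complex `β`. In Mathlib `Complex.Gamma` takes the value `0` at
its poles, so that terms with `α k + β ∈ {0, -1, -2, …}` are `0`, in agreement with `1 / Γ = 0`
there. -/
noncomputable def mittagLeffler (α : ℝ) (β z : ℂ) : ℂ :=
  ∑' k : ℕ, z ^ k / Complex.Gamma ((α : ℂ) * (k : ℂ) + β)

/-- The one-parameter Mittag-Leffler function `E_α = E_{α,1}`. -/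
noncomputable def mittagLefflerOne (α : ℝ) (z : ℂ) : ℂ :=
  mittagLeffler α 1 z

/-! In the coordinate `w = log ζ`, Hankel's formula says that `2πi / Γ(s)` is the contour integral
of `exp (exp w) * exp ((1 - s) w)`, whose rays `Im w = ±θ` may have any `π/2 < θ ≤ π`; all powers of
`ζ` become entire functions and no branch cut appears. Taking `s = α k + 1` and summing a geometric
series gives `2πi E_α(z) = ∫ exp (exp w) * exp (α w) / (exp (α w) - z) dw`.

Since `|arg λ| > απ/2`, some `θ > π/2` satisfies `α θ < |arg λ|`. Then `exp (α w)` stays in a sector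
whose distance from `μ s`, for `s > 0`, is at least `d s`, uniformly for `μ` in a closed disc about
`λ` (`exists_forall_le_norm_exp_sub_mul`). Hence `E_α(μ s) = O(1/s)` on the disc
(`norm_mittagLefflerOne_le`), and Cauchy's estimates on its boundary, whose radius does not depend
on `s`, bound every `λ`-derivative; `s = t ^ α` gives (i).

For (ii), `E_α' = E_{α,α} / α`: the `l`-th derivative of `E_{α,α}(λ s)` is `α / s` times the `(l +
1)`-st derivative of `E_α(λ s)`, which supplies the second factor `t ^ (-α)`. -/

open MeasureTheory Set Filter Topology

/-! ### Contour integrals of Hankel type -/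

/-- The integral along the Hankel contour in logarithmic coordinates: the vertical segment on
`Re w = ρ` with `|Im w| ≤ θ`, joined to the two horizontal rays `Im w = ±θ`. -/
noncomputable def hankelIntegral (θ ρ : ℝ) (f : ℂ → ℂ) : ℂ :=
  Complex.I * (∫ y in (-θ)..θ, f (ρ + y * Complex.I)) +
    (∫ x in Ioi ρ, f (x + θ * Complex.I)) - ∫ x in Ioi ρ, f (x + (-θ : ℝ) * Complex.I)

/-- Integrability along the three pieces of the Hankel contour. -/
structure HankelIntegrable (θ ρ : ℝ) (f : ℂ → ℂ) : Prop where
  vert : IntervalIntegrable (fun y : ℝ => f (ρ + y * Complex.I)) volume (-θ) θ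
  upper : IntegrableOn (fun x : ℝ => f (x + θ * Complex.I)) (Ioi ρ)
  lower : IntegrableOn (fun x : ℝ => f (x + (-θ : ℝ) * Complex.I)) (Ioi ρ)

/-- The integral of the norm along the Hankel contour. -/
noncomputable def hankelNorm (θ ρ : ℝ) (f : ℂ → ℂ) : ℝ :=
  (∫ y in (-θ)..θ, ‖f (ρ + y * Complex.I)‖) +
    (∫ x in Ioi ρ, ‖f (x + θ * Complex.I)‖) + ∫ x in Ioi ρ, ‖f (x + (-θ : ℝ) * Complex.I)‖

/-- The closed half strip to the right of the contour. -/
def halfStrip (θ ρ : ℝ) : Set ℂ := {w | ρ ≤ w.re ∧ |w.im| ≤ θ}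

lemma ofReal_add_mul_I_mem_halfStrip {θ ρ x y : ℝ} (hx : ρ ≤ x) (hy : |y| ≤ θ) :
    (x + y * Complex.I : ℂ) ∈ halfStrip θ ρ := by
  simp [halfStrip, hx, hy]

lemma HankelIntegrable.const_mul {θ ρ : ℝ} {f : ℂ → ℂ} (c : ℂ) (h : HankelIntegrable θ ρ f) :
    HankelIntegrable θ ρ (fun w => c * f w) :=
  ⟨h.vert.const_mul c, h.upper.const_mul c, h.lower.const_mul c⟩

lemma hankelIntegral_const_mul {θ ρ : ℝ} (c : ℂ) (f : ℂ → ℂ) :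
    hankelIntegral θ ρ (fun w => c * f w) = c * hankelIntegral θ ρ f := by
  simp only [hankelIntegral, intervalIntegral.integral_const_mul, integral_const_mul]
  ring

lemma hankelIntegral_sub {θ ρ : ℝ} {f g : ℂ → ℂ} (hf : HankelIntegrable θ ρ f)
    (hg : HankelIntegrable θ ρ g) :
    hankelIntegral θ ρ (fun w => f w - g w) = hankelIntegral θ ρ f - hankelIntegral θ ρ g := by
  simp only [hankelIntegral]
  rw [intervalIntegral.integral_sub hf.vert hg.vert, integral_sub hf.upper hg.upper,
    integral_sub hf.lower hg.lower]
  ring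

lemma hankelIntegral_sum {θ ρ : ℝ} {ι : Type*} (s : Finset ι) {f : ι → ℂ → ℂ}
    (hf : ∀ i ∈ s, HankelIntegrable θ ρ (f i)) :
    hankelIntegral θ ρ (fun w => ∑ i ∈ s, f i w) = ∑ i ∈ s, hankelIntegral θ ρ (f i) := by
  simp only [hankelIntegral]
  rw [intervalIntegral.integral_finsetSum (fun i hi => (hf i hi).vert),
    integral_finsetSum _ (fun i hi => (hf i hi).upper),
    integral_finsetSum _ (fun i hi => (hf i hi).lower), Finset.sum_sub_distrib,
    Finset.sum_add_distrib, Finset.mul_sum]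

lemma hankelIntegral_congr {θ ρ : ℝ} (hθ : 0 ≤ θ) {f g : ℂ → ℂ}
    (h : EqOn f g (halfStrip θ ρ)) : hankelIntegral θ ρ f = hankelIntegral θ ρ g := by
  have h1 : (∫ y in (-θ)..θ, f (ρ + y * Complex.I)) = ∫ y in (-θ)..θ, g (ρ + y * Complex.I) := by
    refine intervalIntegral.integral_congr fun y hy => h ?_
    rw [uIcc_of_le (by linarith)] at hy
    exact ofReal_add_mul_I_mem_halfStrip le_rfl (abs_le.2 hy)
  have h2 (c : ℝ) (hc : |c| ≤ θ) : (∫ x in Ioi ρ, f (x + c * Complex.I)) =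
      ∫ x in Ioi ρ, g (x + c * Complex.I) :=
    setIntegral_congr_fun measurableSet_Ioi fun x hx =>
      h (ofReal_add_mul_I_mem_halfStrip (le_of_lt hx) hc)
  rw [hankelIntegral, hankelIntegral, h1, h2 θ (abs_of_nonneg hθ).le,
    h2 (-θ) (by rw [abs_neg, abs_of_nonneg hθ])]

lemma hankelNorm_nonneg {θ ρ : ℝ} (hθ : 0 ≤ θ) (f : ℂ → ℂ) : 0 ≤ hankelNorm θ ρ f := by
  have h1 : 0 ≤ ∫ y in (-θ)..θ, ‖f (ρ + y * Complex.I)‖ :=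
    intervalIntegral.integral_nonneg (by linarith) fun _ _ => norm_nonneg _
  have h2 (c : ℝ) : 0 ≤ ∫ x in Ioi ρ, ‖f (x + c * Complex.I)‖ :=
    integral_nonneg fun _ => norm_nonneg _
  have := h2 θ
  have := h2 (-θ)
  unfold hankelNorm
  linarith

lemma norm_hankelIntegral_mul_le {θ ρ B : ℝ} (hθ : 0 ≤ θ) {h g : ℂ → ℂ}
    (hh : HankelIntegrable θ ρ h) (hg : ∀ w ∈ halfStrip θ ρ, ‖g w‖ ≤ B) :
    ‖hankelIntegral θ ρ (fun w => h w * g w)‖ ≤ hankelNorm θ ρ h * B := by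
  have hb (w : ℂ) (hw : w ∈ halfStrip θ ρ) : ‖h w * g w‖ ≤ ‖h w‖ * B := by
    rw [norm_mul]; exact mul_le_mul_of_nonneg_left (hg w hw) (norm_nonneg _)
  have h1 : ‖∫ y in (-θ)..θ, h (ρ + y * Complex.I) * g (ρ + y * Complex.I)‖ ≤
      (∫ y in (-θ)..θ, ‖h (ρ + y * Complex.I)‖) * B := by
    rw [← intervalIntegral.integral_mul_const]
    refine intervalIntegral.norm_integral_le_of_norm_le (by linarith) (ae_of_all _ fun y hy => ?_)
      (hh.vert.norm.mul_const B)
    exact hb _ (ofReal_add_mul_I_mem_halfStrip le_rfl (abs_le.2 ⟨hy.1.le, hy.2⟩))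
  have h2 (c : ℝ) (hc : |c| ≤ θ) (hi : IntegrableOn (fun x : ℝ => h (x + c * Complex.I)) (Ioi ρ)) :
      ‖∫ x in Ioi ρ, h (x + c * Complex.I) * g (x + c * Complex.I)‖ ≤
      (∫ x in Ioi ρ, ‖h (x + c * Complex.I)‖) * B := by
    rw [← integral_mul_const]
    refine norm_integral_le_of_norm_le (hi.norm.mul_const B)
      ((ae_restrict_mem measurableSet_Ioi).mono fun x hx => ?_)
    exact hb _ (ofReal_add_mul_I_mem_halfStrip (le_of_lt hx) hc)
  have h3 := h2 θ (abs_of_nonneg hθ).le hh.upper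
  have h4 := h2 (-θ) (by rw [abs_neg, abs_of_nonneg hθ]) hh.lower
  unfold hankelIntegral hankelNorm
  refine (norm_sub_le _ _).trans ?_
  refine (add_le_add_left (norm_add_le _ _) _).trans ?_
  rw [norm_mul, Complex.norm_I, one_mul]
  linarith

/-- The two contours differ by the boundary of a rectangle, so Cauchy's theorem applies. -/
lemma hankelIntegral_eq_of_differentiableOn {θ ρ ρ' : ℝ} (hθ : 0 ≤ θ) (hρ : ρ ≤ ρ') {f : ℂ → ℂ}
    (hf : DifferentiableOn ℂ f (halfStrip θ ρ)) (hi : HankelIntegrable θ ρ f) :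
    hankelIntegral θ ρ f = hankelIntegral θ ρ' f := by
  have key := Complex.integral_boundary_rect_eq_zero_of_differentiableOn f
    ⟨ρ, -θ⟩ ⟨ρ', θ⟩ (hf.mono ?_)
  · have h1 := intervalIntegral.integral_Ioi_sub_Ioi hi.upper hρ
    have h2 := intervalIntegral.integral_Ioi_sub_Ioi hi.lower hρ
    simp only [smul_eq_mul] at key
    unfold hankelIntegral
    linear_combination -key + h1 - h2
  · intro w hw
    rw [Complex.mem_reProdIm, uIcc_of_le hρ, uIcc_of_le (by simpa using hθ)] at hw
    exact ⟨hw.1.1, abs_le.2 hw.2⟩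

/-! ### Decay of the Hankel integrand and deformation of its contour -/

lemma integrableOn_exp_neg_mul_exp_mul_exp {c : ℝ} (hc : 0 < c) (p ρ : ℝ) :
    IntegrableOn (fun x : ℝ => Real.exp (-(c * Real.exp x)) * Real.exp (p * x)) (Ioi ρ) := by
  refine integrable_of_isBigO_exp_neg one_pos (by fun_prop) ?_
  refine Asymptotics.IsBigO.of_bound 1 ?_
  have h : Tendsto (fun x : ℝ => Real.exp x / x) atTop atTop := by
    simpa using Real.tendsto_exp_div_pow_atTop 1
  filter_upwards [h.eventually_ge_atTop ((p + 1) / c), eventually_gt_atTop 0] with x hx hx0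
  rw [div_le_div_iff₀ hc hx0] at hx
  rw [← Real.exp_add, Real.norm_of_nonneg (Real.exp_pos _).le,
    Real.norm_of_nonneg (Real.exp_pos _).le, one_mul, Real.exp_le_exp]
  linarith

lemma tendsto_exp_neg_mul_exp_mul_exp {c : ℝ} (hc : 0 < c) (p : ℝ) :
    Tendsto (fun x : ℝ => Real.exp (-(c * Real.exp x)) * Real.exp (p * x)) atTop (𝓝 0) := by
  have h : Tendsto (fun x : ℝ => Real.exp x / x) atTop atTop := by
    simpa using Real.tendsto_exp_div_pow_atTop 1
  have h0 : Tendsto (fun x : ℝ => Real.exp (-x)) atTop (𝓝 0) :=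
    Real.tendsto_exp_atBot.comp tendsto_neg_atTop_atBot
  refine squeeze_zero' (Eventually.of_forall fun x => by positivity) ?_ h0
  filter_upwards [h.eventually_ge_atTop ((p + 1) / c), eventually_gt_atTop 0] with x hx hx0
  rw [div_le_div_iff₀ hc hx0] at hx
  rw [← Real.exp_add, Real.exp_le_exp]
  linarith

lemma norm_exp_exp_mul_exp (p x y : ℝ) :
    ‖Complex.exp (Complex.exp (x + y * Complex.I)) * Complex.exp (p * (x + y * Complex.I))‖ =
      Real.exp (-(-Real.cos y * Real.exp x)) * Real.exp (p * x) := by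
  rw [norm_mul, Complex.norm_exp, Complex.norm_exp, Complex.exp_re]
  simp
  ring_nf

lemma hankelIntegrable_exp_exp_mul {θ : ℝ} (hθ0 : 0 ≤ θ) (hθ : Real.cos θ < 0) (p ρ : ℝ)
    {g : ℂ → ℂ} (hg : ContinuousOn g (halfStrip θ ρ)) {B : ℝ}
    (hB : ∀ w ∈ halfStrip θ ρ, ‖g w‖ ≤ B) :
    HankelIntegrable θ ρ (fun w => Complex.exp (Complex.exp w) * Complex.exp (p * w) * g w) := by
  have hF : ContinuousOn (fun w => Complex.exp (Complex.exp w) * Complex.exp (p * w) * g w)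
      (halfStrip θ ρ) := by fun_prop
  have h2 (c : ℝ) (hc : |c| ≤ θ) (hcos : Real.cos c < 0) : IntegrableOn (fun x : ℝ =>
      Complex.exp (Complex.exp (x + c * Complex.I)) * Complex.exp (p * (x + c * Complex.I)) *
        g (x + c * Complex.I)) (Ioi ρ) := by
    refine Integrable.mono' ((integrableOn_exp_neg_mul_exp_mul_exp
      (neg_pos.2 hcos) p ρ).mul_const B) ?_ ?_
    · refine ContinuousOn.aestronglyMeasurable ?_ measurableSet_Ioi
      exact hF.comp (f := fun x : ℝ => (x + c * Complex.I : ℂ)) (by fun_prop)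
        fun x hx => ofReal_add_mul_I_mem_halfStrip (le_of_lt hx) hc
    · refine (ae_restrict_mem measurableSet_Ioi).mono fun x hx => ?_
      rw [norm_mul, norm_exp_exp_mul_exp]
      exact mul_le_mul_of_nonneg_left (hB _ (ofReal_add_mul_I_mem_halfStrip (le_of_lt hx) hc))
        (by positivity)
  refine ⟨ContinuousOn.intervalIntegrable ?_, h2 θ (abs_of_nonneg hθ0).le hθ,
    h2 (-θ) (by rw [abs_neg, abs_of_nonneg hθ0]) (by rwa [Real.cos_neg])⟩
  rw [uIcc_of_le (by linarith)]
  exact hF.comp (f := fun y : ℝ => (ρ + y * Complex.I : ℂ)) (by fun_prop)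
    fun y hy => ofReal_add_mul_I_mem_halfStrip le_rfl (abs_le.2 hy)

lemma hankelIntegrable_exp_exp {θ : ℝ} (hθ0 : 0 ≤ θ) (hθ : Real.cos θ < 0) (p ρ : ℝ) :
    HankelIntegrable θ ρ (fun w => Complex.exp (Complex.exp w) * Complex.exp (p * w)) := by
  simpa using hankelIntegrable_exp_exp_mul hθ0 hθ p ρ (g := fun _ => 1) (by fun_prop) (B := 1)
    (by simp)

lemma integrableOn_ray_exp_exp {b : ℝ} (hb : Real.cos b < 0) (p ρ : ℝ) :
    IntegrableOn (fun x : ℝ => Complex.exp (Complex.exp (x + b * Complex.I)) *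
      Complex.exp (p * (x + b * Complex.I))) (Ioi ρ) := by
  refine Integrable.mono' (integrableOn_exp_neg_mul_exp_mul_exp (neg_pos.2 hb) p ρ)
    (Continuous.aestronglyMeasurable (by fun_prop)) (ae_of_all _ fun x => ?_)
  rw [norm_exp_exp_mul_exp]

/-- Cauchy's theorem on the rectangle between `Re w = ρ` and `Re w = X`: the right edge vanishes as
`X → ∞`, because `cos ≤ -c` on the whole strip. -/
lemma integral_ray_sub_integral_ray {a b c : ℝ} (hc : 0 < c) (hab : a ≤ b)
    (hcos : ∀ y ∈ Icc a b, Real.cos y ≤ -c) (p ρ : ℝ) :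
    (∫ x in Ioi ρ, Complex.exp (Complex.exp (x + (a : ℝ) * Complex.I)) *
        Complex.exp (p * (x + (a : ℝ) * Complex.I))) -
      (∫ x in Ioi ρ, Complex.exp (Complex.exp (x + (b : ℝ) * Complex.I)) *
        Complex.exp (p * (x + (b : ℝ) * Complex.I))) =
    Complex.I * ∫ y in a..b, Complex.exp (Complex.exp (ρ + y * Complex.I)) *
        Complex.exp (p * (ρ + y * Complex.I)) := by
  set F : ℂ → ℂ := fun w => Complex.exp (Complex.exp w) * Complex.exp (p * w) with hF
  have hFd : Differentiable ℂ F := by fun_prop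
  have ha : Real.cos a < 0 := (hcos a ⟨le_rfl, hab⟩).trans_lt (by linarith)
  have hb : Real.cos b < 0 := (hcos b ⟨hab, le_rfl⟩).trans_lt (by linarith)
  have t1 := intervalIntegral_tendsto_integral_Ioi ρ (integrableOn_ray_exp_exp ha p ρ) tendsto_id
  have t2 := intervalIntegral_tendsto_integral_Ioi ρ (integrableOn_ray_exp_exp hb p ρ) tendsto_id
  have t3 : Tendsto (fun X : ℝ => Complex.I * ∫ y in a..b, F (X + y * Complex.I)) atTop (𝓝 0) := by
    have hbd (X y : ℝ) (hy : y ∈ uIoc a b) :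
        ‖F (X + y * Complex.I)‖ ≤ Real.exp (-(c * Real.exp X)) * Real.exp (p * X) := by
      rw [uIoc_of_le hab] at hy
      rw [hF, norm_exp_exp_mul_exp]
      have := hcos y ⟨hy.1.le, hy.2⟩
      gcongr
      linarith
    have h0 : Tendsto (fun X : ℝ => Real.exp (-(c * Real.exp X)) * Real.exp (p * X) * |b - a|)
        atTop (𝓝 0) := by simpa using (tendsto_exp_neg_mul_exp_mul_exp hc p).mul_const |b - a|
    refine squeeze_zero_norm (fun X => ?_) h0
    rw [norm_mul, Complex.norm_I, one_mul]
    exact intervalIntegral.norm_integral_le_of_norm_le_const fun y hy => hbd X y hy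
  have hX (X : ℝ) : (∫ x in ρ..X, F (x + a * Complex.I)) - (∫ x in ρ..X, F (x + b * Complex.I)) +
      Complex.I * (∫ y in a..b, F (X + y * Complex.I)) =
      Complex.I * ∫ y in a..b, F (ρ + y * Complex.I) := by
    have := Complex.integral_boundary_rect_eq_zero_of_differentiableOn F ⟨ρ, a⟩ ⟨X, b⟩
      hFd.differentiableOn
    simp only [smul_eq_mul] at this
    linear_combination this
  have t4 := (t1.sub t2).add t3
  rw [add_zero] at t4
  refine tendsto_nhds_unique t4 ?_
  refine tendsto_const_nhds.congr fun X => (hX X).symm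

/-- At angle `π` the rays become real integrals, so the contour can be evaluated there. -/
lemma hankelIntegral_exp_exp_eq_pi {θ : ℝ} (hθ : Real.pi / 2 < θ) (hθ' : θ ≤ Real.pi) (p ρ : ℝ) :
    hankelIntegral θ ρ (fun w => Complex.exp (Complex.exp w) * Complex.exp (p * w)) =
      hankelIntegral Real.pi ρ (fun w => Complex.exp (Complex.exp w) * Complex.exp (p * w)) := by
  have hc : Real.cos θ < 0 :=
    Real.cos_neg_of_pi_div_two_lt_of_lt hθ (by linarith [Real.pi_pos])
  have hcos (y : ℝ) (hy : y ∈ Icc θ Real.pi) : Real.cos y ≤ - -Real.cos θ := by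
    rw [neg_neg]
    exact Real.cos_le_cos_of_nonneg_of_le_pi (by linarith [Real.pi_pos]) hy.2 hy.1
  have h1 := integral_ray_sub_integral_ray (neg_pos.2 hc) hθ' hcos p ρ
  have h2 := integral_ray_sub_integral_ray (a := -Real.pi) (b := -θ) (neg_pos.2 hc) (by linarith)
    (fun y hy => by
      rw [← Real.cos_neg]; exact hcos _ ⟨by linarith [hy.2], by linarith [hy.1]⟩) p ρ
  have hi (a b : ℝ) : IntervalIntegrable (fun y : ℝ =>
      Complex.exp (Complex.exp (ρ + y * Complex.I)) * Complex.exp (p * (ρ + y * Complex.I)))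
      volume a b := Continuous.intervalIntegrable (by fun_prop) _ _
  have h3 := intervalIntegral.integral_add_adjacent_intervals (hi (-Real.pi) (-θ)) (hi (-θ) θ)
  have h4 := intervalIntegral.integral_add_adjacent_intervals (hi (-Real.pi) θ) (hi θ Real.pi)
  unfold hankelIntegral
  linear_combination h1 + h2 + Complex.I * h3 + Complex.I * h4

lemma hankelIntegral_exp_exp_eq {θ : ℝ} (hθ0 : 0 ≤ θ) (hθ : Real.cos θ < 0) (p ρ ρ' : ℝ) :
    hankelIntegral θ ρ (fun w => Complex.exp (Complex.exp w) * Complex.exp (p * w)) =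
      hankelIntegral θ ρ' (fun w => Complex.exp (Complex.exp w) * Complex.exp (p * w)) := by
  have h (r r' : ℝ) (hr : r ≤ r') := hankelIntegral_eq_of_differentiableOn hθ0 hr
    (f := fun w => Complex.exp (Complex.exp w) * Complex.exp (p * w)) (by fun_prop)
    (hankelIntegrable_exp_exp hθ0 hθ p r)
  rcases le_total ρ ρ' with hr | hr
  · exact h _ _ hr
  · exact (h _ _ hr).symm

/-- Integration by parts: the difference of the two integrands is the derivative of `exp (exp w) *
exp (-s w)`, which tends to `0` at both ends. This mirrors `Γ(s + 1) = s Γ(s)`. -/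
lemma hankelIntegral_exp_exp_recurrence {θ : ℝ} (hθ0 : 0 ≤ θ) (hθ : Real.cos θ < 0) (s ρ : ℝ) :
    hankelIntegral θ ρ
        (fun w => Complex.exp (Complex.exp w) * Complex.exp ((1 - s : ℝ) * w)) =
      s * hankelIntegral θ ρ
        (fun w => Complex.exp (Complex.exp w) * Complex.exp ((-s : ℝ) * w)) := by
  set G : ℂ → ℂ := fun w => Complex.exp (Complex.exp w) * Complex.exp ((-s : ℝ) * w) with hG
  set G' : ℂ → ℂ := fun w => Complex.exp (Complex.exp w) * Complex.exp ((1 - s : ℝ) * w) -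
    s * (Complex.exp (Complex.exp w) * Complex.exp ((-s : ℝ) * w)) with hG'
  have hd (w : ℂ) : HasDerivAt G (G' w) w := by
    have h1 : HasDerivAt (fun w => Complex.exp (Complex.exp w)) _ w :=
      (Complex.hasDerivAt_exp w).cexp
    have h2 : HasDerivAt (fun w => Complex.exp ((-s : ℝ) * w)) _ w :=
      ((hasDerivAt_id w).const_mul ((-s : ℝ) : ℂ)).cexp
    refine (h1.mul h2).congr_deriv ?_
    have : Complex.exp ((1 - s : ℝ) * w) = Complex.exp w * Complex.exp ((-s : ℝ) * w) := by
      rw [← Complex.exp_add]; push_cast; ring_nf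
    simp only [hG', this, id]
    push_cast
    ring
  have hi1 := hankelIntegrable_exp_exp hθ0 hθ (1 - s) ρ
  have hi2 := (hankelIntegrable_exp_exp hθ0 hθ (-s) ρ).const_mul (s : ℂ)
  have hray (b : ℝ) (hb : Real.cos b < 0) :
      ∫ x in Ioi ρ, G' (x + b * Complex.I) = - G (ρ + b * Complex.I) := by
    have hdx (x : ℝ) : HasDerivAt (fun x : ℝ => G (x + b * Complex.I)) (G' (x + b * Complex.I)) x := by
      have := (hd (x + b * Complex.I)).comp (x : ℂ)
        ((hasDerivAt_id (x : ℂ)).add_const (b * Complex.I))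
      simpa using this.comp_ofReal
    have hlim : Tendsto (fun x : ℝ => G (x + b * Complex.I)) atTop (𝓝 0) := by
      refine squeeze_zero_norm (fun x => ?_)
        (tendsto_exp_neg_mul_exp_mul_exp (neg_pos.2 hb) (-s))
      rw [hG, norm_exp_exp_mul_exp]
    have hint : IntegrableOn (fun x : ℝ => G' (x + b * Complex.I)) (Ioi ρ) :=
      (integrableOn_ray_exp_exp hb (1 - s) ρ).sub
        ((integrableOn_ray_exp_exp hb (-s) ρ).const_mul (s : ℂ))
    rw [integral_Ioi_of_hasDerivAt_of_tendsto (hdx ρ).continuousAt.continuousWithinAt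
      (fun x _ => hdx x) hint hlim, zero_sub]
  have hvert : Complex.I * ∫ y in (-θ)..θ, G' (ρ + y * Complex.I) =
      G (ρ + θ * Complex.I) - G (ρ + (-θ : ℝ) * Complex.I) := by
    rw [← intervalIntegral.integral_const_mul]
    refine intervalIntegral.integral_eq_sub_of_hasDerivAt
      (f := fun y : ℝ => G (ρ + y * Complex.I)) (fun y _ => ?_) ?_
    · have := (hd (ρ + y * Complex.I)).comp (y : ℂ)
        (((hasDerivAt_id (y : ℂ)).mul_const Complex.I).const_add (ρ : ℂ))
      simpa [mul_comm] using this.comp_ofReal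
    · exact Continuous.intervalIntegrable (by fun_prop) _ _
  have hzero : hankelIntegral θ ρ G' = 0 := by
    rw [hankelIntegral, hvert, hray θ hθ, hray (-θ) (by rwa [Real.cos_neg])]
    ring
  rw [← hankelIntegral_const_mul, ← sub_eq_zero, ← hankelIntegral_sub hi1 hi2]
  exact hzero

/-! ### Evaluation of the contour integral: Hankel's formula -/

lemma hankelIntegral_pi_exp_exp (p ρ : ℝ) :
    hankelIntegral Real.pi ρ (fun w => Complex.exp (Complex.exp w) * Complex.exp (p * w)) =
      Complex.I * (∫ y in (-Real.pi)..Real.pi, Complex.exp (Complex.exp (ρ + y * Complex.I)) *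
        Complex.exp (p * (ρ + y * Complex.I))) +
      2 * Complex.I * (Real.sin (Real.pi * p) *
        ∫ x in Ioi ρ, Real.exp (-Real.exp x) * Real.exp (p * x) : ℝ) := by
  have h1 (x : ℝ) : Complex.exp (Complex.exp (x + Real.pi * Complex.I)) *
      Complex.exp (p * (x + Real.pi * Complex.I)) = Complex.exp (Real.pi * p * Complex.I) *
        (Real.exp (-Real.exp x) * Real.exp (p * x) : ℝ) := by
    rw [Complex.exp_add x, Complex.exp_pi_mul_I, mul_add, Complex.exp_add]
    push_cast
    ring_nf
  have h2 (x : ℝ) : Complex.exp (Complex.exp (x + (-Real.pi : ℝ) * Complex.I)) *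
      Complex.exp (p * (x + (-Real.pi : ℝ) * Complex.I)) = Complex.exp (-(Real.pi * p) * Complex.I) *
        (Real.exp (-Real.exp x) * Real.exp (p * x) : ℝ) := by
    rw [Complex.exp_add x, Complex.ofReal_neg, neg_mul, Complex.exp_neg (Real.pi * Complex.I),
      Complex.exp_pi_mul_I, mul_add, Complex.exp_add]
    push_cast
    ring_nf
  unfold hankelIntegral
  simp only [h1, h2]
  rw [integral_const_mul, integral_const_mul, integral_complex_ofReal, add_sub_assoc, ← sub_mul]
  have h3 : Complex.exp (Real.pi * p * Complex.I) - Complex.exp (-(Real.pi * p) * Complex.I) =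
      2 * Complex.I * Real.sin (Real.pi * p) := by
    rw [Complex.ofReal_sin, Complex.sin]
    push_cast
    linear_combination (Complex.exp (Real.pi * p * Complex.I) -
      Complex.exp (-(Real.pi * p) * Complex.I)) * Complex.I_mul_I
  rw [h3]
  push_cast
  ring

lemma tendsto_integral_exp_neg_exp {p : ℝ} (hp : 0 < p) :
    Tendsto (fun ρ : ℝ => ∫ x in Ioi ρ, Real.exp (-Real.exp x) * Real.exp (p * x)) atBot
      (𝓝 (Real.Gamma p)) := by
  have h1 (ρ : ℝ) : ∫ x in Ioi ρ, Real.exp (-Real.exp x) * Real.exp (p * x) =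
      ∫ t in Ioi (Real.exp ρ), Real.exp (-t) * t ^ (p - 1) := by
    rw [← integral_comp_exp_Ioi]
    refine setIntegral_congr_fun measurableSet_Ioi fun x _ => ?_
    simp only [smul_eq_mul]
    rw [← Real.exp_mul, mul_left_comm, ← Real.exp_add x]
    ring_nf
  simp only [h1]
  rw [Real.Gamma_eq_integral hp]
  have hi := Real.GammaIntegral_convergent hp
  have h2 (ρ : ℝ) : ∫ t in Ioi (Real.exp ρ), Real.exp (-t) * t ^ (p - 1) =
      ∫ t in Ioi (Real.exp ρ), Real.exp (-t) * t ^ (p - 1) ∂(volume.restrict (Ioi 0)) := by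
    rw [Measure.restrict_restrict measurableSet_Ioi,
      inter_eq_left.2 (Ioi_subset_Ioi (Real.exp_pos ρ).le)]
  simp only [h2]
  have hc : AECover (volume.restrict (Ioi (0 : ℝ))) (atBot : Filter ℝ)
      (fun ρ => Ioi (Real.exp ρ)) := by
    refine ⟨?_, fun _ => measurableSet_Ioi⟩
    refine (ae_restrict_mem measurableSet_Ioi).mono fun x hx => ?_
    exact Real.tendsto_exp_atBot.eventually_lt_const hx
  exact hc.integral_tendsto_of_countably_generated hi

/-- Let the abscissa tend to `-∞`: the factor `exp ((1 - s) r)` kills the segment, the rays give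
`sin (π (1 - s)) * Γ(1 - s)`, and the reflection formula concludes. -/
lemma hankelIntegral_pi_of_lt_one {s : ℝ} (hs0 : 0 < s) (hs1 : s < 1) (ρ : ℝ) :
    hankelIntegral Real.pi ρ
        (fun w => Complex.exp (Complex.exp w) * Complex.exp ((1 - s : ℝ) * w)) =
      2 * Real.pi * Complex.I / Complex.Gamma s := by
  have hp : 0 < 1 - s := by linarith
  have hcos : Real.cos Real.pi < 0 := by simp
  have hb (r y : ℝ) (hr : r ≤ 0) : ‖Complex.exp (Complex.exp (r + y * Complex.I)) *
      Complex.exp ((1 - s : ℝ) * (r + y * Complex.I))‖ ≤ Real.exp 1 * Real.exp ((1 - s) * r) := by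
    rw [norm_exp_exp_mul_exp]
    gcongr
    have := Real.neg_one_le_cos y
    have := Real.cos_le_one y
    have := Real.exp_le_one_iff.2 hr
    have := Real.exp_pos r
    nlinarith
  have hv : Tendsto (fun r : ℝ => Complex.I * ∫ y in (-Real.pi)..Real.pi,
      Complex.exp (Complex.exp (r + y * Complex.I)) *
        Complex.exp ((1 - s : ℝ) * (r + y * Complex.I))) atBot (𝓝 0) := by
    have h0 : Tendsto (fun r : ℝ => Real.exp 1 * Real.exp ((1 - s) * r) * |Real.pi - -Real.pi|)
        atBot (𝓝 0) := by
      have := ((Real.tendsto_exp_atBot.comp (tendsto_id.const_mul_atBot hp)).const_mul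
        (Real.exp 1)).mul_const |Real.pi - -Real.pi|
      simpa using this
    refine squeeze_zero_norm' ?_ h0
    filter_upwards [eventually_le_atBot 0] with r hr
    rw [norm_mul, Complex.norm_I, one_mul]
    exact intervalIntegral.norm_integral_le_of_norm_le_const fun y _ => hb r y hr
  have ht := hv.add (((Complex.continuous_ofReal.tendsto _).comp
    ((tendsto_integral_exp_neg_exp hp).const_mul (Real.sin (Real.pi * (1 - s))))).const_mul
      (2 * Complex.I))
  have hconst : Tendsto (fun _ : ℝ => hankelIntegral Real.pi ρ
        (fun w => Complex.exp (Complex.exp w) * Complex.exp ((1 - s : ℝ) * w))) atBot (𝓝 _) :=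
    ht.congr fun r => by
      rw [hankelIntegral_exp_exp_eq Real.pi_pos.le hcos (1 - s) ρ r, hankelIntegral_pi_exp_exp]
      rfl
  rw [tendsto_nhds_unique tendsto_const_nhds hconst, zero_add]
  have hrefl := Real.Gamma_mul_Gamma_one_sub s
  have hsin : 0 < Real.sin (Real.pi * s) :=
    Real.sin_pos_of_pos_of_lt_pi (by positivity) (by nlinarith [Real.pi_pos])
  have hG := Real.Gamma_pos_of_pos hs0
  have hsin' : Real.sin (Real.pi * (1 - s)) = Real.sin (Real.pi * s) := by
    rw [mul_sub, mul_one, Real.sin_pi_sub]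
  have hval : Real.sin (Real.pi * (1 - s)) * Real.Gamma (1 - s) = Real.pi / Real.Gamma s := by
    rw [hsin', eq_div_iff hG.ne']
    rw [eq_div_iff hsin.ne'] at hrefl
    linear_combination hrefl
  rw [hval, Complex.Gamma_ofReal]
  push_cast
  ring

/-- Here the rays cancel and the segment does not vanish: its integrand tends to `1`, which yields
`2πi`. -/
lemma hankelIntegral_pi_one (ρ : ℝ) :
    hankelIntegral Real.pi ρ
        (fun w => Complex.exp (Complex.exp w) * Complex.exp ((1 - 1 : ℝ) * w)) =
      2 * Real.pi * Complex.I := by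
  have hcos : Real.cos Real.pi < 0 := by simp
  have hv : Tendsto (fun r : ℝ => Complex.I * ∫ y in (-Real.pi)..Real.pi,
      (Complex.exp (Complex.exp (r + y * Complex.I)) - 1)) atBot (𝓝 0) := by
    have h0 : Tendsto (fun r : ℝ => 2 * Real.exp r * |Real.pi - -Real.pi|) atBot (𝓝 0) := by
      simpa using (Real.tendsto_exp_atBot.const_mul 2).mul_const |Real.pi - -Real.pi|
    refine squeeze_zero_norm' ?_ h0
    filter_upwards [eventually_le_atBot 0] with r hr
    rw [norm_mul, Complex.norm_I, one_mul]
    refine intervalIntegral.norm_integral_le_of_norm_le_const fun y _ => ?_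
    have hn : ‖Complex.exp (r + y * Complex.I)‖ = Real.exp r := by simp [Complex.norm_exp]
    rw [← hn]
    exact Complex.norm_exp_sub_one_le (hn.trans_le (Real.exp_le_one_iff.2 hr))
  have hconst : Tendsto (fun _ : ℝ => hankelIntegral Real.pi ρ
        (fun w => Complex.exp (Complex.exp w) * Complex.exp ((1 - 1 : ℝ) * w)) -
        2 * Real.pi * Complex.I) atBot (𝓝 0) :=
    hv.congr fun r => by
      rw [hankelIntegral_exp_exp_eq Real.pi_pos.le hcos (1 - 1) ρ r, hankelIntegral_pi_exp_exp,
        intervalIntegral.integral_sub (Continuous.intervalIntegrable (by fun_prop) _ _)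
          (by simp)]
      simp
      ring
  exact sub_eq_zero.1 (tendsto_nhds_unique tendsto_const_nhds hconst)

/-- **Hankel's formula** for the reciprocal Gamma function at a positive real number. -/
theorem hankelIntegral_exp_exp {θ : ℝ} (hθ : Real.pi / 2 < θ) (hθ' : θ ≤ Real.pi) {s : ℝ}
    (hs : 0 < s) (ρ : ℝ) :
    hankelIntegral θ ρ
        (fun w => Complex.exp (Complex.exp w) * Complex.exp ((1 - s : ℝ) * w)) =
      2 * Real.pi * Complex.I / Complex.Gamma s := by
  rw [hankelIntegral_exp_exp_eq_pi hθ hθ']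
  -- The recurrence propagates the formula from `(0, 1]` to `(0, n + 1]`.
  suffices H : ∀ n : ℕ, ∀ s : ℝ, 0 < s → s ≤ n + 1 → hankelIntegral Real.pi ρ
      (fun w => Complex.exp (Complex.exp w) * Complex.exp ((1 - s : ℝ) * w)) =
      2 * Real.pi * Complex.I / Complex.Gamma s from
    H ⌈s⌉₊ s hs ((Nat.le_ceil s).trans (by linarith))
  intro n
  induction n with
  | zero =>
    intro s hs hs1
    rcases lt_or_eq_of_le hs1 with h | h
    · exact hankelIntegral_pi_of_lt_one hs (by simpa using h) ρ
    · obtain rfl : s = 1 := by simpa using h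
      rw [hankelIntegral_pi_one]
      simp
  | succ n ih =>
    intro s hs hsn
    rcases le_or_gt s (n + 1) with h | h
    · exact ih s hs h
    · have hs1 : 0 < s - 1 := by linarith [n.cast_nonneg (α := ℝ)]
      have h1 := ih (s - 1) hs1 (by push_cast at hsn; linarith)
      rw [hankelIntegral_exp_exp_recurrence Real.pi_pos.le (by simp),
        show -(s - 1) = 1 - s by ring] at h1
      have hne : ((s - 1 : ℝ) : ℂ) ≠ 0 := by exact_mod_cast hs1.ne'
      have h2 := Complex.Gamma_add_one _ hne
      rw [show ((s - 1 : ℝ) : ℂ) + 1 = s by push_cast; ring] at h2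
      have hG : Complex.Gamma ((s - 1 : ℝ) : ℂ) ≠ 0 :=
        Complex.Gamma_ne_zero_of_re_pos (by simpa using hs1)
      rw [h2]
      rw [eq_div_iff hG] at h1
      rw [eq_div_iff (mul_ne_zero hne hG), ← h1]
      ring

/-! ### Integral representation and derivative of `E_α` -/

lemma mittagLeffler_term_eq_hankelIntegral {α θ : ℝ} (hα : 0 < α) (hθ : Real.pi / 2 < θ)
    (hθ' : θ ≤ Real.pi) (ρ : ℝ) (z : ℂ) (k : ℕ) :
    2 * Real.pi * Complex.I * (z ^ k / Complex.Gamma ((α : ℂ) * k + 1)) =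
      -- The trivial factor `exp (0 * w)` keeps the integrand in the family with exponent `p`, here
      -- `p = 0`.
      hankelIntegral θ ρ (fun w => Complex.exp (Complex.exp w) * Complex.exp ((0 : ℝ) * w) *
        (z * Complex.exp (-α * w)) ^ k) := by
  have h := hankelIntegral_exp_exp hθ hθ' (s := α * k + 1) (by positivity) ρ
  have h2 : (fun w => Complex.exp (Complex.exp w) * Complex.exp ((0 : ℝ) * w) *
        (z * Complex.exp (-α * w)) ^ k) = fun w => z ^ k * (Complex.exp (Complex.exp w) *
          Complex.exp ((1 - (α * k + 1) : ℝ) * w)) := by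
    funext w
    rw [mul_pow, ← Complex.exp_nat_mul]
    push_cast
    simp only [zero_mul, Complex.exp_zero]
    ring_nf
  rw [h2, hankelIntegral_const_mul, h]
  push_cast
  ring

lemma norm_mul_exp_neg_le {α θ ρ : ℝ} (hα : 0 < α) (z : ℂ) {w : ℂ} (hw : w ∈ halfStrip θ ρ) :
    ‖z * Complex.exp (-α * w)‖ ≤ ‖z‖ * Real.exp (-α * ρ) := by
  rw [norm_mul, Complex.norm_exp]
  gcongr
  simp
  nlinarith [hw.1]

/-- The free abscissa `ρ` makes the ratio as small as desired, so convergence follows without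
Stirling's formula. -/
lemma norm_mittagLeffler_term_le {α θ : ℝ} (hα : 0 < α) (hθ : Real.pi / 2 < θ)
    (hθ' : θ ≤ Real.pi) (ρ : ℝ) (z : ℂ) (k : ℕ) :
    ‖z ^ k / Complex.Gamma ((α : ℂ) * k + 1)‖ ≤
      hankelNorm θ ρ (fun w => Complex.exp (Complex.exp w) * Complex.exp ((0 : ℝ) * w)) *
        (‖z‖ * Real.exp (-α * ρ)) ^ k := by
  have hθ0 : 0 ≤ θ := by linarith [Real.pi_pos]
  have hc : Real.cos θ < 0 :=
    Real.cos_neg_of_pi_div_two_lt_of_lt hθ (by linarith [Real.pi_pos])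
  have h1 := norm_hankelIntegral_mul_le hθ0 (hankelIntegrable_exp_exp hθ0 hc 0 ρ)
    (g := fun w => (z * Complex.exp (-α * w)) ^ k) (B := (‖z‖ * Real.exp (-α * ρ)) ^ k)
    fun w hw => by
      rw [norm_pow]
      exact pow_le_pow_left₀ (norm_nonneg _) (norm_mul_exp_neg_le hα z hw) k
  rw [← mittagLeffler_term_eq_hankelIntegral hα hθ hθ', norm_mul] at h1
  refine le_trans (le_mul_of_one_le_left (norm_nonneg _) ?_) h1
  have : ‖(2 * Real.pi * Complex.I : ℂ)‖ = 2 * Real.pi := by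
    simp [abs_of_pos Real.pi_pos]
  rw [this]
  linarith [Real.pi_gt_three]

lemma exists_mul_exp_neg_le {α : ℝ} (hα : 0 < α) (R : ℝ) :
    ∃ ρ : ℝ, 0 ≤ ρ ∧ R * Real.exp (-α * ρ) ≤ 1 / 2 := by
  have h : Tendsto (fun ρ : ℝ => R * Real.exp (-α * ρ)) atTop (𝓝 (R * 0)) :=
    (Real.tendsto_exp_atBot.comp
      (tendsto_id.const_mul_atTop_of_neg (neg_lt_zero.2 hα))).const_mul R
  rw [mul_zero] at h
  exact ((eventually_ge_atTop 0).and (h.eventually_le_const (by norm_num))).exists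

lemma exists_norm_mittagLeffler_term_le {α : ℝ} (hα : 0 < α) (R : ℝ) :
    ∃ K : ℝ, ∀ z : ℂ, ‖z‖ ≤ R → ∀ k : ℕ,
      ‖z ^ k / Complex.Gamma ((α : ℂ) * k + 1)‖ ≤ K * (1 / 2) ^ k := by
  obtain ⟨ρ, -, hρ⟩ := exists_mul_exp_neg_le hα R
  refine ⟨_, fun z hz k => (norm_mittagLeffler_term_le hα (θ := Real.pi)
    (by linarith [Real.pi_pos]) le_rfl ρ z k).trans
    (mul_le_mul_of_nonneg_left ?_ (hankelNorm_nonneg Real.pi_pos.le _))⟩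
  exact pow_le_pow_left₀ (by positivity)
    ((mul_le_mul_of_nonneg_right hz (Real.exp_pos _).le).trans hρ) k

lemma summable_const_mul_half_pow (K : ℝ) : Summable fun k : ℕ => K * (1 / 2 : ℝ) ^ k :=
  (summable_geometric_of_lt_one (by norm_num) (by norm_num)).mul_left K

lemma differentiable_mittagLefflerOne {α : ℝ} (hα : 0 < α) :
    Differentiable ℂ (mittagLefflerOne α) := by
  intro z
  obtain ⟨K, hK⟩ := exists_norm_mittagLeffler_term_le hα (‖z‖ + 1)
  have h := Complex.differentiableOn_tsum_of_summable_norm (summable_const_mul_half_pow K)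
    (F := fun (k : ℕ) z => z ^ k / Complex.Gamma ((α : ℂ) * k + 1)) (U := Metric.ball 0 (‖z‖ + 1))
    (fun k => by fun_prop) Metric.isOpen_ball
    (fun k w hw => hK w (by simpa using (mem_ball_zero_iff.1 hw).le) k)
  exact h.differentiableAt (Metric.isOpen_ball.mem_nhds (by simp))

/-- Termwise, `(k + 1) / Γ(α (k + 1) + 1) = 1 / (α Γ(α k + α))`. -/
lemma deriv_mittagLefflerOne {α : ℝ} (hα : 0 < α) (z : ℂ) :
    deriv (mittagLefflerOne α) z = (α : ℂ)⁻¹ * mittagLeffler α α z := by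
  obtain ⟨K, hK⟩ := exists_norm_mittagLeffler_term_le hα (‖z‖ + 1)
  have h : HasSum _ (deriv (mittagLefflerOne α) z) :=
    Complex.hasSum_deriv_of_summable_norm (summable_const_mul_half_pow K)
      (F := fun (k : ℕ) z => z ^ k / Complex.Gamma ((α : ℂ) * k + 1))
      (U := Metric.ball 0 (‖z‖ + 1)) (fun k => by fun_prop) Metric.isOpen_ball
      (fun k w hw => hK w (by simpa using (mem_ball_zero_iff.1 hw).le) k) (z := z) (by simp)
  have hα' : (α : ℂ) ≠ 0 := by exact_mod_cast hα.ne'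
  rw [← hasSum_nat_add_iff' 1] at h
  simp only [Finset.sum_range_one, deriv_div_const, deriv_pow_field, Nat.add_sub_cancel,
    Nat.cast_zero, zero_mul, zero_div, sub_zero] at h
  rw [← h.tsum_eq, mittagLeffler, ← tsum_mul_left]
  refine tsum_congr fun k => ?_
  have hk : (α : ℂ) * (k + 1 : ℕ) ≠ 0 := mul_ne_zero hα' (Nat.cast_ne_zero.2 k.succ_ne_zero)
  rw [Complex.Gamma_add_one _ hk, show (α : ℂ) * (k + 1 : ℕ) = α * k + α by push_cast; ring] at *
  have hG : Complex.Gamma ((α : ℂ) * k + α) ≠ 0 :=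
    Complex.Gamma_ne_zero_of_re_pos (by simp; positivity)
  field_simp
  push_cast
  ring

/-- The finite geometric sum leaves the remainder `u ^ n / (1 - u)`, which is at most `q ^ n / (1 -
q)` on the contour. -/
lemma mittagLefflerOne_eq_hankelIntegral {α θ ρ : ℝ} (hα : 0 < α) (hθ : Real.pi / 2 < θ)
    (hθ' : θ ≤ Real.pi) {z : ℂ} (hz : ‖z‖ * Real.exp (-α * ρ) < 1) :
    2 * Real.pi * Complex.I * mittagLefflerOne α z =
      hankelIntegral θ ρ (fun w => Complex.exp (Complex.exp w) * Complex.exp ((0 : ℝ) * w) *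
        (1 - z * Complex.exp (-α * w))⁻¹) := by
  have hθ0 : 0 ≤ θ := by linarith [Real.pi_pos]
  have hc : Real.cos θ < 0 :=
    Real.cos_neg_of_pi_div_two_lt_of_lt hθ (by linarith [Real.pi_pos])
  set q := ‖z‖ * Real.exp (-α * ρ) with hq
  have hq0 : 0 ≤ q := by positivity
  set h : ℂ → ℂ := fun w => Complex.exp (Complex.exp w) * Complex.exp ((0 : ℝ) * w) with hh
  set u : ℂ → ℂ := fun w => z * Complex.exp (-α * w) with hu
  have hub (w : ℂ) (hw : w ∈ halfStrip θ ρ) : ‖u w‖ ≤ q := norm_mul_exp_neg_le hα z hw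
  have hlow (w : ℂ) (hw : w ∈ halfStrip θ ρ) : 1 - q ≤ ‖1 - u w‖ := by
    have := norm_sub_norm_le 1 (u w)
    rw [norm_one] at this
    linarith [hub w hw]
  have hne (w : ℂ) (hw : w ∈ halfStrip θ ρ) : 1 - u w ≠ 0 :=
    norm_pos_iff.1 (lt_of_lt_of_le (by linarith) (hlow w hw))
  have hinv (w : ℂ) (hw : w ∈ halfStrip θ ρ) : ‖(1 - u w)⁻¹‖ ≤ (1 - q)⁻¹ := by
    rw [norm_inv]
    exact inv_anti₀ (by linarith) (hlow w hw)
  have hi : HankelIntegrable θ ρ h := hankelIntegrable_exp_exp hθ0 hc 0 ρ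
  have hik (k : ℕ) : HankelIntegrable θ ρ (fun w => h w * u w ^ k) :=
    hankelIntegrable_exp_exp_mul hθ0 hc 0 ρ (by fun_prop) (B := q ^ k) fun w hw => by
      rw [norm_pow]; exact pow_le_pow_left₀ (norm_nonneg _) (hub w hw) k
  have hiinv : HankelIntegrable θ ρ (fun w => h w * (1 - u w)⁻¹) :=
    hankelIntegrable_exp_exp_mul hθ0 hc 0 ρ
      (ContinuousOn.inv₀ (by fun_prop) hne) hinv
  have hpart (n : ℕ) : hankelIntegral θ ρ (fun w => h w * (1 - u w)⁻¹) -
      2 * Real.pi * Complex.I * ∑ k ∈ Finset.range n, z ^ k / Complex.Gamma ((α : ℂ) * k + 1) =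
      hankelIntegral θ ρ (fun w => h w * (u w ^ n * (1 - u w)⁻¹)) := by
    rw [Finset.mul_sum, Finset.sum_congr rfl fun k _ =>
      mittagLeffler_term_eq_hankelIntegral hα hθ hθ' ρ z k]
    have hiu : HankelIntegrable θ ρ (fun w => h w * (u w ^ n * (1 - u w)⁻¹)) :=
      hankelIntegrable_exp_exp_mul hθ0 hc 0 ρ
        (ContinuousOn.mul (by fun_prop) (ContinuousOn.inv₀ (by fun_prop) hne))
        (B := q ^ n * (1 - q)⁻¹) fun w hw => by
          rw [norm_mul, norm_pow]
          exact mul_le_mul (pow_le_pow_left₀ (norm_nonneg _) (hub w hw) n) (hinv w hw)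
            (norm_nonneg _) (by positivity)
    rw [← hankelIntegral_sum (Finset.range n) fun k _ => hik k, sub_eq_iff_eq_add',
      ← sub_eq_iff_eq_add, ← hankelIntegral_sub hiinv hiu]
    refine hankelIntegral_congr hθ0 fun w hw => ?_
    have := hne w hw
    have hg := geom_sum_mul_neg (u w) n
    rw [← Finset.mul_sum]
    field_simp
    linear_combination (-h w) * hg
  have hbd (n : ℕ) : ‖hankelIntegral θ ρ (fun w => h w * (1 - u w)⁻¹) -
      2 * Real.pi * Complex.I * ∑ k ∈ Finset.range n, z ^ k / Complex.Gamma ((α : ℂ) * k + 1)‖ ≤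
      hankelNorm θ ρ h * (q ^ n * (1 - q)⁻¹) := by
    rw [hpart]
    refine norm_hankelIntegral_mul_le hθ0 hi fun w hw => ?_
    rw [norm_mul, norm_pow]
    exact mul_le_mul (pow_le_pow_left₀ (norm_nonneg _) (hub w hw) n) (hinv w hw)
      (norm_nonneg _) (by positivity)
  have hsum : Summable fun k : ℕ => z ^ k / Complex.Gamma ((α : ℂ) * k + 1) :=
    Summable.of_norm_bounded ((summable_geometric_of_lt_one hq0 hz).mul_left _)
      fun k => norm_mittagLeffler_term_le hα hθ hθ' ρ z k
  have ht1 := (hsum.hasSum.tendsto_sum_nat.const_mul (2 * Real.pi * Complex.I)).const_sub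
    (hankelIntegral θ ρ (fun w => h w * (1 - u w)⁻¹))
  have ht2 : Tendsto (fun n : ℕ => hankelNorm θ ρ h * (q ^ n * (1 - q)⁻¹)) atTop (𝓝 0) := by
    simpa using ((tendsto_pow_atTop_nhds_zero_of_lt_one hq0 hz).mul_const (1 - q)⁻¹).const_mul
      (hankelNorm θ ρ h)
  have := tendsto_nhds_unique ht1 (squeeze_zero_norm hbd ht2)
  exact (sub_eq_zero.1 this).symm

/-! ### Uniform bounds and Cauchy estimates -/

lemma norm_mittagLefflerOne_le {α θ δ : ℝ} (hα : 0 < α) (hθ : Real.pi / 2 < θ)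
    (hθ' : θ ≤ Real.pi) (hδ : 0 < δ) {z : ℂ}
    (hz : ∀ w ∈ halfStrip θ 0, δ ≤ ‖Complex.exp (α * w) - z‖) :
    ‖mittagLefflerOne α z‖ ≤
      hankelNorm θ 0 (fun w => Complex.exp (Complex.exp w) * Complex.exp (α * w)) / δ := by
  have hθ0 : 0 ≤ θ := by linarith [Real.pi_pos]
  have hc : Real.cos θ < 0 :=
    Real.cos_neg_of_pi_div_two_lt_of_lt hθ (by linarith [Real.pi_pos])
  -- The series representation needs `ρ` depending on `z`. The contour is then moved back to
  -- abscissa `0`, past no pole, so that the constant does not depend on `z`.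
  obtain ⟨ρ, hρ0, hρ⟩ := exists_mul_exp_neg_le hα ‖z‖
  have hne (w : ℂ) (hw : w ∈ halfStrip θ 0) : Complex.exp (α * w) - z ≠ 0 :=
    norm_pos_iff.1 (hδ.trans_le (hz w hw))
  have hinv (w : ℂ) (hw : w ∈ halfStrip θ 0) : ‖(Complex.exp (α * w) - z)⁻¹‖ ≤ δ⁻¹ := by
    rw [norm_inv]
    exact inv_anti₀ hδ (hz w hw)
  have hi := hankelIntegrable_exp_exp_mul hθ0 hc α 0
    (ContinuousOn.inv₀ (f := fun w => Complex.exp (α * w) - z) (by fun_prop) hne) hinv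
  have hdef := hankelIntegral_eq_of_differentiableOn hθ0 hρ0
    (DifferentiableOn.mul (by fun_prop) (DifferentiableOn.inv (by fun_prop) hne)) hi
  have heq : 2 * Real.pi * Complex.I * mittagLefflerOne α z = hankelIntegral θ 0 (fun w =>
      Complex.exp (Complex.exp w) * Complex.exp (α * w) * (Complex.exp (α * w) - z)⁻¹) := by
    rw [mittagLefflerOne_eq_hankelIntegral hα hθ hθ' (by linarith : _ < (1 : ℝ))]
    refine Eq.trans (hankelIntegral_congr hθ0 fun w hw => ?_) hdef.symm
    have he : Complex.exp (-α * w) = (Complex.exp (α * w))⁻¹ := by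
      rw [← Complex.exp_neg, neg_mul]
    have h1 := hne w ⟨hρ0.trans hw.1, hw.2⟩
    have h2 := Complex.exp_ne_zero (α * w)
    have h3 : 1 - z * Complex.exp (-α * w) =
        (Complex.exp (α * w))⁻¹ * (Complex.exp (α * w) - z) := by
      rw [he]; field_simp
    simp only [h3, Complex.ofReal_zero, zero_mul, Complex.exp_zero, mul_one, mul_inv, inv_inv]
    change _ = Complex.exp (Complex.exp w) * Complex.exp (α * w) * (Complex.exp (α * w) - z)⁻¹
    ring
  have h1 := norm_hankelIntegral_mul_le hθ0 (hankelIntegrable_exp_exp hθ0 hc α 0) hinv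
  rw [← heq, norm_mul, ← div_eq_mul_inv] at h1
  refine le_trans (le_mul_of_one_le_left (norm_nonneg _) ?_) h1
  have : ‖(2 * Real.pi * Complex.I : ℂ)‖ = 2 * Real.pi := by
    simp [abs_of_pos Real.pi_pos]
  rw [this]
  linarith [Real.pi_gt_three]

lemma abs_arg_exp {w : ℂ} (hw : |w.im| < Real.pi) : |(Complex.exp w).arg| = |w.im| := by
  rw [← Complex.log_im, Complex.log_exp (abs_lt.1 hw).1 (abs_lt.1 hw).2.le]

lemma exists_forall_le_norm_exp_sub_mul {α θ : ℝ} (hα : 0 < α) (hα1 : α < 1)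
    (hθ' : θ ≤ Real.pi) {lam : ℂ} (hlam : lam ≠ 0) (harg : α * θ < |lam.arg|) :
    ∃ d : ℝ, 0 < d ∧ ∀ μ ∈ Metric.closedBall lam d, ∀ s : ℝ, 0 < s → ∀ w : ℂ, |w.im| ≤ θ →
      d * s ≤ ‖Complex.exp (α * w) - μ * s‖ := by
  -- The angle with `1` equals `|arg|` but stays continuous across the negative axis, where `arg`
  -- jumps; this covers `|arg λ| = π`.
  have hcont : ContinuousAt (fun z : ℂ => InnerProductGeometry.angle 1 z) lam :=
    (InnerProductGeometry.continuousAt_angle (x := ((1 : ℂ), lam)) one_ne_zero hlam).comp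
      (f := fun z : ℂ => ((1 : ℂ), z)) (by fun_prop)
  have hev := hcont.eventually_const_lt (u := α * θ)
    (by simpa only [Complex.angle_one_left hlam] using harg)
  obtain ⟨ε, hε, hball⟩ := Metric.eventually_nhds_iff.1 hev
  refine ⟨ε / 2, by positivity, fun μ hμ s hs w hw => ?_⟩
  have hsc : (s : ℂ) ≠ 0 := by exact_mod_cast hs.ne'
  -- Dividing by `s > 0` preserves the sector and reduces the claim to `s = 1`.
  set v := Complex.exp (α * w - Real.log s) with hv
  have hvs : Complex.exp (α * w) = v * s := by
    rw [hv, Complex.exp_sub, ← Complex.ofReal_exp, Real.exp_log hs]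
    field_simp
  have him : (α * w - Real.log s : ℂ).im = α * w.im := by simp
  have hvarg : |v.arg| ≤ α * θ := by
    have h1 : |α * w.im| ≤ α * θ := by
      rw [abs_mul, abs_of_pos hα]; exact mul_le_mul_of_nonneg_left hw hα.le
    rw [hv, abs_arg_exp, him]
    · exact h1
    · rw [him]
      refine h1.trans_lt ?_
      nlinarith [Real.pi_pos]
  have hfar : ε ≤ dist v lam := by
    by_contra! hlt
    have := hball hlt
    rw [Complex.angle_one_left (Complex.exp_ne_zero _)] at this
    linarith
  have htri := dist_triangle v μ lam
  rw [Metric.mem_closedBall] at hμ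
  rw [hvs, ← sub_mul, norm_mul, Complex.norm_real, Real.norm_of_nonneg hs.le, ← dist_eq_norm]
  exact mul_le_mul_of_nonneg_right (by linarith) hs.le

lemma exists_norm_iteratedDeriv_mittagLefflerOne_le {α : ℝ} (hα0 : 0 < α) (hα1 : α < 1) {lam : ℂ}
    (hlam : lam ≠ 0) (harg : α * Real.pi / 2 < |lam.arg|) (l : ℕ) :
    ∃ M : ℝ, 0 < M ∧ ∀ s : ℝ, 0 < s →
      ‖iteratedDeriv l (fun z : ℂ => mittagLefflerOne α (z * s)) lam‖ ≤ M / s := by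
  obtain ⟨θ, hθ, hθ'⟩ : ∃ θ, Real.pi / 2 < θ ∧ θ < min Real.pi (|lam.arg| / α) :=
    exists_between (lt_min (by linarith [Real.pi_pos]) (by rw [lt_div_iff₀ hα0]; linarith))
  have hθπ : θ ≤ Real.pi := hθ'.le.trans (min_le_left _ _)
  have hθα : α * θ < |lam.arg| := by
    have := hθ'.trans_le (min_le_right _ _)
    rw [lt_div_iff₀ hα0] at this
    linarith
  obtain ⟨d, hd, hdist⟩ := exists_forall_le_norm_exp_sub_mul hα0 hα1 hθπ hlam hθα
  set K := hankelNorm θ 0 (fun w => Complex.exp (Complex.exp w) * Complex.exp (α * w))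
  have hK : 0 ≤ K := hankelNorm_nonneg (by linarith [Real.pi_pos]) _
  -- The summand `1` only ensures positivity, as `K` is merely known to be nonnegative.
  refine ⟨l.factorial * (K / d) / d ^ l + 1, by positivity, fun s hs => ?_⟩
  have hdiff : Differentiable ℂ (fun z : ℂ => mittagLefflerOne α (z * s)) :=
    (differentiable_mittagLefflerOne hα0).comp (by fun_prop)
  have h := Complex.norm_iteratedDeriv_le_of_forall_mem_sphere_norm_le l hd hdiff.diffContOnCl
    (C := K / (d * s)) fun μ hμ => norm_mittagLefflerOne_le hα0 hθ hθπ (by positivity)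
      fun w hw => hdist μ (Metric.sphere_subset_closedBall hμ) s hs w hw.2
  refine h.trans ?_
  rw [add_div, show (l.factorial : ℝ) * (K / (d * s)) / d ^ l =
    l.factorial * (K / d) / d ^ l / s by field_simp]
  have : 0 < 1 / s := by positivity
  linarith

lemma iteratedDeriv_succ_mittagLefflerOne_comp_mul {α : ℝ} (hα : 0 < α) (l : ℕ) (s z : ℂ) :
    iteratedDeriv (l + 1) (fun z : ℂ => mittagLefflerOne α (z * s)) z =
      s * (α : ℂ)⁻¹ * iteratedDeriv l (fun z : ℂ => mittagLeffler α α (z * s)) z := by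
  have hderiv : deriv (fun z : ℂ => mittagLefflerOne α (z * s)) =
      fun z => s * (α : ℂ)⁻¹ * mittagLeffler α α (z * s) := by
    funext z
    rw [mul_assoc, ← deriv_mittagLefflerOne hα, mul_comm s]
    have h1 := (differentiable_mittagLefflerOne hα (z * s)).hasDerivAt
    have h2 : HasDerivAt (fun z : ℂ => z * s) s z := by
      simpa using (hasDerivAt_id z).mul_const s
    exact (h1.comp z h2).deriv
  rw [iteratedDeriv_succ', hderiv, iteratedDeriv_const_mul_field]

theorem lemma4 (α : ℝ) (hα0 : 0 < α) (hα1 : α < 1) (lam : ℂ) (hlam : lam ≠ 0)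
    (harg : α * Real.pi / 2 < |Complex.arg lam|) (harg' : |Complex.arg lam| ≤ Real.pi) (l : ℕ) :
    ∃ M : ℝ, 0 < M ∧ ∃ M' : ℝ, 0 < M' ∧ ∃ t₀ : ℝ, 0 < t₀ ∧
      (∀ t : ℝ, t₀ < t →
        ‖iteratedDeriv l (fun z : ℂ => mittagLefflerOne α (z * ((t ^ α : ℝ) : ℂ))) lam‖
          ≤ M / t ^ α) ∧
      (∀ t : ℝ, t₀ < t →
        ‖iteratedDeriv l (fun z : ℂ => mittagLeffler α (α : ℂ) (z * ((t ^ α : ℝ) : ℂ))) lam‖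
          ≤ M' / t ^ (2 * α)) := by
  obtain ⟨M, hM, hbound⟩ := exists_norm_iteratedDeriv_mittagLefflerOne_le hα0 hα1 hlam harg l
  obtain ⟨N, hN, hbound'⟩ :=
    exists_norm_iteratedDeriv_mittagLefflerOne_le hα0 hα1 hlam harg (l + 1)
  -- The bounds hold for all `t > 0`, so `t₀ = 1` is arbitrary.
  refine ⟨M, hM, α * N, by positivity, 1, one_pos, fun t ht => hbound _ (by positivity),
    fun t ht => ?_⟩
  have ht0 : 0 < t := by linarith
  have hs : 0 < t ^ α := by positivity
  have h := hbound' _ hs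
  rw [iteratedDeriv_succ_mittagLefflerOne_comp_mul hα0, norm_mul, norm_mul, norm_inv,
    Complex.norm_real, Complex.norm_real, Real.norm_of_nonneg hs.le,
    Real.norm_of_nonneg hα0.le, ← div_eq_mul_inv, le_div_iff₀ hs] at h
  rw [mul_comm 2 α, Real.rpow_mul ht0.le, Real.rpow_two, le_div_iff₀ (by positivity)]
  have h2 := mul_le_mul_of_nonneg_left h hα0.le
  refine le_trans (le_of_eq ?_) h2
  generalize
    ‖iteratedDeriv l (fun z : ℂ => mittagLeffler α (α : ℂ) (z * ((t ^ α : ℝ) : ℂ))) lam‖ = D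
  field_simp
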